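/- Graphs are finite undirected multigraphs (self-loops and parallel edges are allowed, and every edge has an identifier that is preserved by contractions). Let $G_0=(V_0,E_0)$ be a simple planar graph, that is, a graph without self-loops and parallel edges that can be drawn in the plane with vertices as distinct points and edges as non-crossing curves. Consider a sequence of $k\ge 0$ edge contractions, where the $i$-th one ($1\le i\le k$) contracts a non-loop edge $u_iv_i$ of $G_{i-1}$ and yields $G_i=(V_i,E_i)$ with $V_i=(V_{i-1}\setminus\{u_i,v_i\})\cup\{s_i\}$: the edge is deleted and all endpoints equal to $u_i$ or $v_i$ are replaced by $s_i$, where $s_i$ is $u_i$, $v_i$ or a new vertex. Let $\phi_i:V_0\to V_i$ map each vertex to the vertex it has been merged into by the first $i$ contractions (so $\phi_0=\mathrm{id}$), and let $\overline{G_i}$ be a maximal simple subgraph of $G_i$, i.e. $G_i$ with self-loops discarded and each group of parallel edges replaced with a single edge of the group. For $W\subseteq V_0$ and $1\le i\le k$, let $\Delta_i^W$ be the set of all edges $s_iy\in E(\overline{G_i})$ such that $\{s_i,y\}\subseteq\phi_i(W)$ and - $u_i\notin\phi_{i-1}(W)$ or $u_iy\notin E(\overline{G_{i-1}})$, and - $v_i\notin\phi_{i-1}(W)$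 or $v_iy\notin E(\overline{G_{i-1}})$. Put $\Psi_W=\sum_{i=1}^k|\Delta_i^W|$. Then for every $W\subseteq V_0$ we have $\Psi_W\le 6|W|$; in particular $\Psi_W=O(|W|)$ with an absolute constant. -/

import Mathlib

namespace PlanarContraction

/-- An embedding of a multigraph in the plane: the vertices are mapped to distinct points, each
edge to a simple curve joining the points of its two ends (a closed one if the edge is a
self-loop), and curves meet vertices and other curves only at their ends. -/
structure PlaneEmbedding {α β : Type*} (G : Graph α β) where
  point : α → EuclideanSpace ℝ (Fin 2)
  curve : β → C(unitInterval, EuclideanSpace ℝ (Fin 2))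
  point_injOn : Set.InjOn point G.vertexSet
  curve_ends : ∀ e ∈ G.edgeSet, ∃ x y, G.IsLink e x y ∧ curve e 0 = point x ∧ curve e 1 = point y
  curve_injOn : ∀ e ∈ G.edgeSet, Set.InjOn (curve e) (Set.Ioo 0 1)
  curve_ne_point : ∀ e ∈ G.edgeSet, ∀ t ∈ Set.Ioo (0 : unitInterval) 1, ∀ x ∈ G.vertexSet,
    curve e t ≠ point x
  curve_disjoint : ∀ e ∈ G.edgeSet, ∀ f ∈ G.edgeSet, e ≠ f →
    Disjoint (curve e '' Set.Ioo 0 1) (curve f '' Set.Ioo 0 1)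

/-- A multigraph is planar if it has an embedding in the plane. -/
def IsPlanar {α β : Type*} (G : Graph α β) : Prop := Nonempty (PlaneEmbedding G)

/-- The data of one contraction: the contracted edge, its two ends `u`, `v`, and the name `s` of
the vertex that results from merging them. -/
structure Contraction (α β : Type*) where
  edge : β
  u : α
  v : α
  s : α

/-- A contraction can be performed on `G` if its edge is an edge `uv` of `G` that is not a
self-loop, and the merged vertex is either called `u` or `v`, or is new. -/
structure Contraction.IsValid {α β : Type*} (c : Contraction α β) (G : Graph α β) : Prop where
  isLink : G.IsLink c.edge c.u c.v
  ne : c.u ≠ c.v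
  fresh : c.s ∉ G.vertexSet \ {c.u, c.v}

open Classical in
/-- The map on vertices that replaces `u` and `v` by `s`. -/
noncomputable def Contraction.merge {α β : Type*} (c : Contraction α β) (x : α) : α :=
  if x = c.u ∨ x = c.v then c.s else x

/-- The graph `G / e`: the edge `e` is deleted, and all endpoints equal to `u` or `v` are replaced
by `s`. The identifiers of the remaining edges are preserved. -/
noncomputable def Contraction.apply {α β : Type*} (c : Contraction α β) (G : Graph α β) :
    Graph α β :=
  (G.deleteEdges {c.edge}).map c.merge

/-- The graph `G_i` obtained from `G₀` by the first `i` contractions `c 0, …, c (i - 1)`. -/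
noncomputable def graphAfter {α β : Type*} (G₀ : Graph α β) (c : ℕ → Contraction α β) :
    ℕ → Graph α β
  | 0 => G₀
  | i + 1 => (c i).apply (graphAfter G₀ c i)

/-- The map `φ_i`, which sends each vertex of `G₀` to the vertex of `G_i` that it has been merged
into by the first `i` contractions. -/
noncomputable def phi {α β : Type*} (c : ℕ → Contraction α β) : ℕ → α → α
  | 0 => id
  | i + 1 => (c i).merge ∘ phi c i

/-- `c 0, …, c (k - 1)` is a sequence of `k` edge contractions on `G₀`. -/
def IsContractionSequence {α β : Type*} (G₀ : Graph α β) (k : ℕ) (c : ℕ → Contraction α β) :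
    Prop :=
  ∀ i < k, (c i).IsValid (graphAfter G₀ c i)

/-- `H` is a maximal simple subgraph of `G`, that is, `G` with its self-loops discarded and
each group of parallel edges replaced by a single edge of the group. -/
def IsMaximalSimpleSubgraph {α β : Type*} (H G : Graph α β) : Prop :=
  Maximal (fun K : Graph α β => K ≤ G ∧ K.Simple) H

/-- The set of new edges that appear in the simplified subgraph induced by the image of `W` as a
result of the contraction `c i`, which turns `G_i` into `G_(i+1)` (in the usual numbering from one
this is the contraction number `i + 1`). Here `Gbar i` is the simplification of `G_i`. -/
def newEdges {α β : Type*} (c : ℕ → Contraction α β) (Gbar : ℕ → Graph α β) (W : Set α) (i : ℕ) :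
    Set β :=
  {e | ∃ y, (Gbar (i + 1)).IsLink e (c i).s y ∧
    (c i).s ∈ phi c (i + 1) '' W ∧ y ∈ phi c (i + 1) '' W ∧
    ((c i).u ∉ phi c i '' W ∨ ¬ (Gbar i).Adj (c i).u y) ∧
    ((c i).v ∉ phi c i '' W ∨ ¬ (Gbar i).Adj (c i).v y)}

/-- The total number `Ψ_W` of new edges over the first `k` contractions. -/
noncomputable def psi {α β : Type*} (c : ℕ → Contraction α β) (Gbar : ℕ → Graph α β) (k : ℕ)
    (W : Set α) : ℕ∞ :=
  ∑ i ∈ Finset.range k, (newEdges c Gbar W i).encard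

end PlanarContraction

/-! Every new edge is charged to an edge of a minor of `G₀` that has `|W|` vertices. Throughout the
contractions each `w ∈ W` owns a connected set `C w`, a cluster, inside the fiber of `φ_i` over
`φ_i(w)`. The clusters are disjoint and together fill the fibers over `φ_i(W)`; at the start they
are singletons.

A contraction creates new edges only if exactly one end, say `u`, lies in `φ_i(W)`. Then one cluster
over `u` that has an edge into the fiber of `v` absorbs that whole fiber. A new edge `sy` means that
`v` was adjacent to `y` and `u` was not, so the enlarged cluster touches some cluster over `y` that
it did not touch before; distinct new edges have distinct `y`. If both ends lie in the image, or
neither does, the clusters stay as they are. Clusters only grow, so no adjacency is lost, and `Ψ_W`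
is at most the number of touching pairs (`IsClusterFamily.exists_absorb`,
`exists_isClusterFamily_succ`).

A linear bound on the number of touching pairs is obtained without Euler's formula. Average degree
at least 8 forces a `K₅` minor, by Mader's argument (`exists_pairwise_touch`), and a plane drawing
has none (`IsPlanar.not_pairwise_touch`), by counting half turns of the vectors between points on
disjoint edges (`exists_disjoint_edges_meet`). -/

namespace PlanarContraction

/-! ### Continuous logarithms and the non-planarity of `K₅`. -/

open Complex in
/-- A nowhere vanishing complex function on a simply connected space has a continuous logarithm. -/
theorem exists_continuous_log {A : Type*} [TopologicalSpace A] [SimplyConnectedSpace A]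
    [LocallyPathConnectedSpace A] (F : C(A, ℂ)) (hF : ∀ z, F z ≠ 0) :
    ∃ L : C(A, ℂ), ∀ z, exp (L z) = F z := by
  obtain ⟨a₀⟩ : Nonempty A := inferInstance
  obtain ⟨L, ⟨-, hL⟩, -⟩ := isCoveringMapOn_exp.existsUnique_continuousMap_lifts F
    (exp_log (hF a₀)) (fun z => by simpa using hF z)
  exact ⟨L, fun z => congrFun hL z⟩

/-- Continuous logarithms of the same function on the line have the same increments. -/
theorem continuous_log_increment_eq {L L' : ℝ → ℂ} (hL : Continuous L) (hL' : Continuous L')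
    (h : ∀ t, Complex.exp (L t) = Complex.exp (L' t)) (s t : ℝ) : L t - L s = L' t - L' s := by
  have h1 : L = fun r => L' r + (L s - L' s) := by
    refine Complex.isCoveringMap_exp.eq_of_comp_eq hL (by fun_prop) ?_ s (by ring)
    funext r
    simp [Complex.exp_add, Complex.exp_sub, h, Complex.exp_ne_zero]
  rw [h1]
  ring

open Classical in
/-- The increment over the unit interval of a continuous logarithm of `γ - p`. -/
noncomputable def logIncrement (γ : ℝ → ℂ) (p : ℂ) : ℂ :=
  if h : ∃ L : ℝ → ℂ, Continuous L ∧ ∀ t, Complex.exp (L t) = γ t - p then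
    h.choose 1 - h.choose 0 else 0

theorem logIncrement_eq {γ : ℝ → ℂ} {p : ℂ} {L : ℝ → ℂ} (hL : Continuous L)
    (h : ∀ t, Complex.exp (L t) = γ t - p) : logIncrement γ p = L 1 - L 0 := by
  have hex : ∃ L : ℝ → ℂ, Continuous L ∧ ∀ t, Complex.exp (L t) = γ t - p := ⟨L, hL, h⟩
  rw [logIncrement, dif_pos hex]
  exact continuous_log_increment_eq hex.choose_spec.1 hL
    (fun t => (hex.choose_spec.2 t).trans (h t).symm) 0 1

theorem exp_logIncrement {γ : ℝ → ℂ} {p : ℂ} (hγ : Continuous γ) (h : ∀ t, γ t ≠ p) :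
    Complex.exp (logIncrement γ p) = (γ 1 - p) / (γ 0 - p) := by
  obtain ⟨L, hL⟩ := exists_continuous_log (A := ℝ) ⟨fun t => γ t - p, by fun_prop⟩
    (fun t => sub_ne_zero.2 (h t))
  rw [logIncrement_eq L.continuous hL, Complex.exp_sub, hL, hL]
  rfl

/-- The relation between the logarithmic increments of two disjoint curves as seen from the ends of
each other. -/
theorem logIncrement_add_logIncrement {γ δ : ℝ → ℂ} (hγ : Continuous γ) (hδ : Continuous δ)
    (h : ∀ s t, γ s ≠ δ t) :
    logIncrement γ (δ 0) + logIncrement δ (γ 1) = logIncrement δ (γ 0) + logIncrement γ (δ 1) := by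
  obtain ⟨L, hL⟩ := exists_continuous_log (A := ℝ × ℝ) ⟨fun z => γ z.1 - δ z.2, by fun_prop⟩
    (fun z => sub_ne_zero.2 (h z.1 z.2))
  have h1 (t : ℝ) : logIncrement γ (δ t) = L (1, t) - L (0, t) :=
    logIncrement_eq (L := fun s => L (s, t)) (by fun_prop) fun s => hL (s, t)
  have h2 (s : ℝ) : logIncrement δ (γ s) = L (s, 1) - L (s, 0) := by
    -- Adding `πi` turns a logarithm of `γ - δ` into one of `δ - γ`.
    rw [logIncrement_eq (L := fun t => L (s, t) + Real.pi * Complex.I) (by fun_prop) fun t => ?_]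
    · ring
    · rw [Complex.exp_add, hL, Complex.exp_pi_mul_I]
      simp
  rw [h1, h1, h2, h2]
  ring

/-- In a continuous map of the complete graph on five vertices to the plane, the images of some two
disjoint edges meet. -/
theorem exists_disjoint_edges_meet (p : Fin 5 → ℂ) (hp : Function.Injective p)
    (γ : Fin 5 → Fin 5 → ℝ → ℂ) (hγ : ∀ i j, i < j → Continuous (γ i j))
    (h0 : ∀ i j, i < j → γ i j 0 = p i) (h1 : ∀ i j, i < j → γ i j 1 = p j) :
    ∃ a b c d : Fin 5, a < b ∧ c < d ∧ a ≠ c ∧ a ≠ d ∧ b ≠ c ∧ b ≠ d ∧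
      ∃ s t, γ a b s = γ c d t := by
  by_contra! hdisj
  -- `p v` is an end of the curve from `v` to a further vertex `w`, and that edge is disjoint from
  -- `ij`.
  have havoid : ∀ v i j, i < j → v ≠ i → v ≠ j → ∀ t, γ i j t ≠ p v := by
    intro v i j hij hvi hvj t ht
    obtain ⟨w, hw⟩ : ∃ w, w ∉ ({v, i, j} : Finset (Fin 5)) := by
      by_contra! hall
      have h2 := Finset.card_le_card (fun x _ => hall x : Finset.univ ⊆ ({v, i, j} : Finset (Fin 5)))
      have h3 : ({v, i, j} : Finset (Fin 5)).card ≤ 3 := Finset.card_le_three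
      simp at h2
      omega
    simp only [Finset.mem_insert, Finset.mem_singleton, not_or] at hw
    rcases lt_or_gt_of_ne hw.1 with hlt | hlt
    · exact hdisj i j w v hij hlt (Ne.symm hw.2.1) hvi.symm (Ne.symm hw.2.2) hvj.symm t 1
        (by rw [h1 _ _ hlt, ht])
    · exact hdisj i j v w hij hlt hvi.symm (Ne.symm hw.2.1) hvj.symm (Ne.symm hw.2.2) t 0
        (by rw [h0 _ _ hlt, ht])
  -- One logarithm is fixed per unordered pair; reversing the direction costs the half turn recorded
  -- by `ε`. The values of `A` then cancel in the relation for two disjoint edges, which leaves an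
  -- equation between integers.
  set A : Fin 5 → Fin 5 → ℂ := fun x y => Complex.log (p (max x y) - p (min x y)) with hA
  have hAsymm : ∀ x y, A x y = A y x := fun x y => by simp only [hA, max_comm, min_comm]
  set ε : Fin 5 → Fin 5 → ℤ := fun x y => if x < y then 0 else 1 with hε
  have hexp : ∀ x y, x ≠ y → Complex.exp (A x y + ε x y * (Real.pi * Complex.I)) = p y - p x := by
    intro x y hxy
    rcases lt_or_gt_of_ne hxy with hlt | hlt
    · have := sub_ne_zero.2 (hp.ne hxy.symm)
      simp [hA, hε, hlt, hlt.le, Complex.exp_log this]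
    · have := sub_ne_zero.2 (hp.ne hxy)
      simp [hA, hε, hlt.le, hlt.not_gt, Complex.exp_add, Complex.exp_log this]
  have hn : ∀ v i j, ∃ n : ℤ, i < j → v ≠ i → v ≠ j → logIncrement (γ i j) (p v) =
      (A v j + ε v j * (Real.pi * Complex.I)) - (A v i + ε v i * (Real.pi * Complex.I)) +
        n * (2 * Real.pi * Complex.I) := by
    intro v i j
    by_cases h : i < j ∧ v ≠ i ∧ v ≠ j
    · obtain ⟨hij, hvi, hvj⟩ := h
      have h2 : Complex.exp (logIncrement (γ i j) (p v)) = Complex.exp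
          ((A v j + ε v j * (Real.pi * Complex.I)) - (A v i + ε v i * (Real.pi * Complex.I))) := by
        rw [exp_logIncrement (hγ _ _ hij) (havoid v i j hij hvi hvj), Complex.exp_sub,
          hexp _ _ hvi, hexp _ _ hvj, h0 _ _ hij, h1 _ _ hij]
      obtain ⟨n, hn⟩ := Complex.exp_eq_exp_iff_exists_int.1 h2
      exact ⟨n, fun _ _ _ => hn⟩
    · exact ⟨0, fun h3 h4 h5 => absurd ⟨h3, h4, h5⟩ h⟩
  choose n hn using hn
  have key : ∀ a b c d : Fin 5, (a < b ∧ c < d ∧ a ≠ c ∧ a ≠ d ∧ b ≠ c ∧ b ≠ d) →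
      (ε c b - ε c a + ε b d - ε b c - ε a d + ε a c - ε d b + ε d a) +
        2 * (n c a b + n b c d - n a c d - n d a b) = 0 := by
    rintro a b c d ⟨hab, hcd, hac, had, hbc, hbd⟩
    have h2 := logIncrement_add_logIncrement (hγ a b hab) (hγ c d hcd)
      (hdisj a b c d hab hcd hac had hbc hbd)
    rw [h0 _ _ hab, h0 _ _ hcd, h1 _ _ hab, h1 _ _ hcd, hn c a b hab hac.symm hbc.symm,
      hn b c d hcd hbc hbd, hn a c d hcd hac had, hn d a b hab had.symm hbd.symm,
      hAsymm b d, hAsymm b c, hAsymm a d, hAsymm a c] at h2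
    have hpi : (Real.pi * Complex.I : ℂ) ≠ 0 := by simp [Real.pi_ne_zero]
    have h3 : (((ε c b - ε c a + ε b d - ε b c - ε a d + ε a c - ε d b + ε d a) +
        2 * (n c a b + n b c d - n a c d - n d a b) : ℤ) : ℂ) * (Real.pi * Complex.I) = 0 := by
      push_cast
      linear_combination h2
    exact_mod_cast (mul_eq_zero.1 h3).resolve_right hpi
  -- Sum over all 15 pairs of disjoint edges. Each `n v i j` occurs in two equations with
  -- coefficient `±2`, so these terms add up to a multiple of 4. The `ε` part is `-2` when the two
  -- edges interleave and `0` otherwise; there is one interleaving pair per four vertices, so the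
  -- total is `-10`, a contradiction modulo 4.
  have e01 := key 0 1 2 3 (by decide)
  have e02 := key 0 1 2 4 (by decide)
  have e03 := key 0 1 3 4 (by decide)
  have e04 := key 0 2 1 3 (by decide)
  have e05 := key 0 2 1 4 (by decide)
  have e06 := key 0 2 3 4 (by decide)
  have e07 := key 0 3 1 2 (by decide)
  have e08 := key 0 3 1 4 (by decide)
  have e09 := key 0 3 2 4 (by decide)
  have e10 := key 0 4 1 2 (by decide)
  have e11 := key 0 4 1 3 (by decide)
  have e12 := key 0 4 2 3 (by decide)
  have e13 := key 1 2 3 4 (by decide)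
  have e14 := key 1 3 2 4 (by decide)
  have e15 := key 1 4 2 3 (by decide)
  simp [hε] at e01 e02 e03 e04 e05 e06 e07 e08 e09 e10 e11 e12 e13 e14 e15
  omega

/-! ### Connected sets, touching, and minors of a plane drawing. -/

/-- A nonempty set of vertices any two of which are joined by a walk that stays in the set. -/
def ConnectedIn {α β : Type*} (G : Graph α β) (T : Set α) : Prop :=
  T.Nonempty ∧ ∀ x ∈ T, ∀ y ∈ T, Relation.ReflTransGen (fun a b => G.Adj a b ∧ a ∈ T ∧ b ∈ T) x y

/-- Two sets of vertices touch if some edge has an end in each of them. -/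
def Touch {α β : Type*} (G : Graph α β) (S T : Set α) : Prop :=
  ∃ a ∈ S, ∃ b ∈ T, G.Adj a b

theorem Touch.symm {α β : Type*} {G : Graph α β} {S T : Set α} (h : Touch G S T) :
    Touch G T S := by
  obtain ⟨a, ha, b, hb, hab⟩ := h
  exact ⟨b, hb, a, ha, hab.symm⟩

theorem Touch.mono {α β : Type*} {G : Graph α β} {S S' T T' : Set α} (h : Touch G S T)
    (hS : S ⊆ S') (hT : T ⊆ T') : Touch G S' T' := by
  obtain ⟨a, ha, b, hb, hab⟩ := h
  exact ⟨a, hS ha, b, hT hb, hab⟩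

theorem connectedIn_singleton {α β : Type*} (G : Graph α β) (x : α) : ConnectedIn G {x} := by
  refine ⟨⟨x, rfl⟩, ?_⟩
  rintro _ rfl _ rfl
  exact .refl

theorem ConnectedIn.union {α β : Type*} {G : Graph α β} {S T : Set α} (hS : ConnectedIn G S)
    (hT : ConnectedIn G T) (h : Touch G S T) : ConnectedIn G (S ∪ T) := by
  obtain ⟨a, ha, b, hb, hab⟩ := h
  have hS' : ∀ x ∈ S, ∀ y ∈ S,
      Relation.ReflTransGen (fun a b => G.Adj a b ∧ a ∈ S ∪ T ∧ b ∈ S ∪ T) x y := fun x hx y hy =>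
    Relation.ReflTransGen.mono (fun _ _ h => ⟨h.1, .inl h.2.1, .inl h.2.2⟩) _ _ (hS.2 x hx y hy)
  have hT' : ∀ x ∈ T, ∀ y ∈ T,
      Relation.ReflTransGen (fun a b => G.Adj a b ∧ a ∈ S ∪ T ∧ b ∈ S ∪ T) x y := fun x hx y hy =>
    Relation.ReflTransGen.mono (fun _ _ h => ⟨h.1, .inr h.2.1, .inr h.2.2⟩) _ _ (hT.2 x hx y hy)
  refine ⟨hS.1.inl, ?_⟩
  rintro x (hx | hx) y (hy | hy)
  · exact hS' x hx y hy
  · exact ((hS' x hx a ha).tail ⟨hab, .inl ha, .inr hb⟩).trans (hT' b hb y hy)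
  · exact ((hT' x hx b hb).tail ⟨hab.symm, .inr hb, .inl ha⟩).trans (hS' a ha y hy)
  · exact hT' x hx y hy

/-- The part of the drawing formed by the vertices in `T` and the edges with both ends in `T`. -/
def PlaneEmbedding.carrier {α β : Type*} {G : Graph α β} (P : PlaneEmbedding G) (T : Set α) :
    Set (EuclideanSpace ℝ (Fin 2)) :=
  P.point '' T ∪ ⋃ e ∈ {e | ∃ x ∈ T, ∃ y ∈ T, G.IsLink e x y}, P.curve e '' Set.Ioo 0 1

theorem PlaneEmbedding.disjoint_carrier {α β : Type*} {G : Graph α β} (P : PlaneEmbedding G)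
    {S T : Set α} (hS : S ⊆ G.vertexSet) (hT : T ⊆ G.vertexSet) (h : Disjoint S T) :
    Disjoint (P.carrier S) (P.carrier T) := by
  rw [Set.disjoint_left] at h ⊢
  rintro z (⟨x, hx, rfl⟩ | hz) (⟨y, hy, hxy⟩ | hz')
  · exact h hx (P.point_injOn (hT hy) (hS hx) hxy ▸ hy)
  · simp only [Set.mem_iUnion, Set.mem_ofPred_eq] at hz'
    obtain ⟨e, ⟨a, -, b, -, hab⟩, t, ht, hte⟩ := hz'
    exact P.curve_ne_point e hab.edge_mem t ht x (hS hx) hte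
  · simp only [Set.mem_iUnion, Set.mem_ofPred_eq] at hz
    obtain ⟨e, ⟨a, -, b, -, hab⟩, t, ht, hte⟩ := hz
    exact P.curve_ne_point e hab.edge_mem t ht y (hT hy) (hte.trans hxy.symm)
  · simp only [Set.mem_iUnion, Set.mem_ofPred_eq] at hz hz'
    obtain ⟨e, ⟨a, ha, b, hb, hab⟩, hze⟩ := hz
    obtain ⟨f, ⟨c, hc, d, hd, hcd⟩, hzf⟩ := hz'
    by_cases hef : e = f
    · subst hef
      rcases hab.left_eq_or_eq hcd with rfl | rfl
      exacts [h ha hc, h ha hd]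
    · exact Set.disjoint_left.1 (P.curve_disjoint e hab.edge_mem f hcd.edge_mem hef) hze hzf

theorem PlaneEmbedding.joinedIn_of_adj {α β : Type*} {G : Graph α β} (P : PlaneEmbedding G)
    {T : Set α} {x y : α} (hx : x ∈ T) (hy : y ∈ T) (h : G.Adj x y) :
    JoinedIn (P.carrier T) (P.point x) (P.point y) := by
  obtain ⟨e, he⟩ := h
  obtain ⟨a, b, hab, h0, h1⟩ := P.curve_ends e he.edge_mem
  have main : a ∈ T → b ∈ T → JoinedIn (P.carrier T) (P.point a) (P.point b) := by
    intro ha hb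
    refine ⟨⟨P.curve e, h0, h1⟩, fun t => ?_⟩
    change P.curve e t ∈ P.carrier T
    rcases eq_or_ne t 0 with rfl | ht0
    · exact .inl ⟨a, ha, h0.symm⟩
    rcases eq_or_ne t 1 with rfl | ht1
    · exact .inl ⟨b, hb, h1.symm⟩
    refine .inr (Set.mem_biUnion (x := e) ⟨a, ha, b, hb, hab⟩ ⟨t, ⟨?_, ?_⟩, rfl⟩)
    · exact lt_of_le_of_ne t.2.1 (Ne.symm ht0)
    · exact lt_of_le_of_ne t.2.2 ht1
  rcases he.eq_and_eq_or_eq_and_eq hab with ⟨rfl, rfl⟩ | ⟨rfl, rfl⟩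
  exacts [main hx hy, (main hy hx).symm]

theorem PlaneEmbedding.joinedIn_of_connectedIn {α β : Type*} {G : Graph α β}
    (P : PlaneEmbedding G) {T : Set α} (hT : ConnectedIn G T) {x y : α} (hx : x ∈ T) (hy : y ∈ T) :
    JoinedIn (P.carrier T) (P.point x) (P.point y) := by
  induction hT.2 x hx y hy with
  | refl => exact .refl (.inl ⟨x, hx, rfl⟩)
  | tail _ h ih => exact (ih h.2.1).trans (P.joinedIn_of_adj h.2.1 h.2.2 h.1)

/-- A planar graph has no complete minor on five vertices. -/
theorem IsPlanar.not_pairwise_touch {α β : Type*} {G : Graph α β} (hG : IsPlanar G)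
    (B : Fin 5 → Set α) (hB : ∀ i, ConnectedIn G (B i)) (hV : ∀ i, B i ⊆ G.vertexSet)
    (hdisj : Pairwise (Function.onFun Disjoint B)) : ¬ Pairwise (Function.onFun (Touch G) B) := by
  intro htouch
  obtain ⟨P⟩ := hG
  choose x hx using fun i => (hB i).1
  let φ : EuclideanSpace ℝ (Fin 2) → ℂ := Complex.orthonormalBasisOneI.repr.symm
  have hφ : Continuous φ := Complex.orthonormalBasisOneI.repr.symm.continuous
  have hφinj : Function.Injective φ := Complex.orthonormalBasisOneI.repr.symm.injective
  -- The edge `ij` of `K₅` is drawn inside the part of the drawing over `B i ∪ B j`; disjoint edges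
  -- use disjoint parts.
  have hj : ∀ i j, i ≠ j → JoinedIn (P.carrier (B i ∪ B j)) (P.point (x i)) (P.point (x j)) :=
    fun i j hij => P.joinedIn_of_connectedIn ((hB i).union (hB j) (htouch hij))
      (.inl (hx i)) (.inr (hx j))
  have hcurve : ∀ i j, ∃ γ : ℝ → ℂ, i < j → Continuous γ ∧ γ 0 = φ (P.point (x i)) ∧
      γ 1 = φ (P.point (x j)) ∧ ∀ t, γ t ∈ φ '' P.carrier (B i ∪ B j) := by
    intro i j
    by_cases hij : i < j
    · let γ := (hj i j hij.ne).somePath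
      refine ⟨fun t => φ (γ.extend t), fun _ => ⟨hφ.comp γ.continuous_extend, by simp, by simp,
        fun t => ⟨_, ?_, rfl⟩⟩⟩
      exact (hj i j hij.ne).somePath_mem (Set.projIcc 0 1 zero_le_one t)
    · exact ⟨0, fun h => absurd h hij⟩
  choose γ hγ using hcurve
  obtain ⟨a, b, c, d, hab, hcd, hac, had, hbc, hbd, s, t, hst⟩ :=
    exists_disjoint_edges_meet (fun i => φ (P.point (x i))) (fun i j hij => by
      by_contra hne
      have := P.point_injOn (hV i (hx i)) (hV j (hx j)) (hφinj hij)
      exact Set.disjoint_left.1 (hdisj hne) (hx i) (this ▸ hx j)) γ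
      (fun i j h => (hγ i j h).1) (fun i j h => (hγ i j h).2.1) (fun i j h => (hγ i j h).2.2.1)
  obtain ⟨z, hz, hzs⟩ := (hγ a b hab).2.2.2 s
  obtain ⟨z', hz', hzt⟩ := (hγ c d hcd).2.2.2 t
  obtain rfl : z = z' := hφinj (hzs.trans (hst.trans hzt.symm))
  refine Set.disjoint_left.1 (P.disjoint_carrier (Set.union_subset (hV a) (hV b))
    (Set.union_subset (hV c) (hV d)) ?_) hz hz'
  simp only [Set.disjoint_union_left, Set.disjoint_union_right]
  exact ⟨⟨hdisj hac, hdisj hbc⟩, hdisj had, hdisj hbd⟩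

/-! ### Large average degree forces a complete minor. -/

section

open Finset

theorem sum_sum_insert {ι : Type*} [DecidableEq ι] {A : Finset ι} {y : ι} (hy : y ∉ A)
    (f : ι → ι → ℕ) (hf : ∀ i j, f i j = f j i) (hf0 : f y y = 0) :
    ∑ i ∈ insert y A, ∑ j ∈ insert y A, f i j = ∑ i ∈ A, ∑ j ∈ A, f i j + 2 * ∑ j ∈ A, f y j := by
  simp only [sum_insert hy, sum_add_distrib, hf0]
  simp only [fun i => hf i y]
  ring

/-- Merging two adjacent vertices with fewer than `m` common neighbours lowers the sum of the
degrees by at most `2 * m`. -/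
theorem sum_card_filter_le_of_merge {ι : Type*} [DecidableEq ι] {R R' : ι → ι → Prop}
    [∀ i j, Decidable (R i j)] [∀ i j, Decidable (R' i j)]
    (hR : ∀ i j, R i j → R j i) (hR' : ∀ i j, R' i j → R' j i)
    (hRi : ∀ i, ¬ R i i) (hRi' : ∀ i, ¬ R' i i) {A : Finset ι} {x y : ι} (hx : x ∈ A) (hy : y ∈ A)
    (hxy : x ≠ y) {m : ℕ} (hm : #{j ∈ A | R x j ∧ R y j} < m)
    (h : ∀ i j, i ≠ x → i ≠ y → j ≠ x → j ≠ y → R i j → R' i j)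
    (h' : ∀ j, j ≠ x → j ≠ y → R x j ∨ R y j → R' x j) :
    ∑ i ∈ A, #{j ∈ A | R i j} ≤ ∑ i ∈ A.erase y, #{j ∈ A.erase y | R' i j} + 2 * m := by
  obtain ⟨B, hB⟩ : ∃ B, B = (A.erase y).erase x := ⟨_, rfl⟩
  have hxB : x ∉ B := by simp [hB]
  have hyB : y ∉ insert x B := by simp [hB, hxy.symm]
  have hAy : A.erase y = insert x B := by rw [hB, insert_erase]; simp [hx, hxy]
  have hA : A = insert y (insert x B) := by rw [← hAy, insert_erase hy]
  have hne : ∀ j ∈ B, j ≠ x ∧ j ≠ y := by simp [hB]; tauto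
  simp only [card_filter] at hm ⊢
  rw [hAy, sum_sum_insert hxB _ (fun i j => by simp only [show R' i j ↔ R' j i from ⟨hR' _ _, hR' _ _⟩])
    (by simp [hRi']), hA, sum_sum_insert hyB _
    (fun i j => by simp only [show R i j ↔ R j i from ⟨hR _ _, hR _ _⟩]) (by simp [hRi]),
    sum_sum_insert hxB _ (fun i j => by simp only [show R i j ↔ R j i from ⟨hR _ _, hR _ _⟩])
      (by simp [hRi]), sum_insert hxB]
  have h1 : ∑ i ∈ B, ∑ j ∈ B, (if R i j then 1 else 0) ≤ ∑ i ∈ B, ∑ j ∈ B, if R' i j then 1 else 0 := by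
    refine sum_le_sum fun i hi => sum_le_sum fun j hj => ?_
    have := h i j (hne i hi).1 (hne i hi).2 (hne j hj).1 (hne j hj).2
    split_ifs <;> first | omega | (exfalso; tauto)
  have h2 : ∑ j ∈ B, (if R x j then 1 else 0) + ∑ j ∈ B, (if R y j then 1 else 0) ≤
      ∑ j ∈ B, (if R' x j then 1 else 0) + ∑ j ∈ B, (if R x j ∧ R y j then 1 else 0) := by
    rw [← sum_add_distrib, ← sum_add_distrib]
    refine sum_le_sum fun j hj => ?_
    have := h' j (hne j hj).1 (hne j hj).2
    split_ifs <;> first | omega | (exfalso; tauto)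
  have h3 : ∑ j ∈ B, (if R x j ∧ R y j then 1 else 0) ≤
      ∑ j ∈ A, (if R x j ∧ R y j then 1 else 0) :=
    sum_le_sum_of_subset (by rw [hA]; exact (subset_insert _ _).trans (subset_insert _ _))
  have h4 : (if R y x then 1 else 0) ≤ 1 := by split_ifs <;> simp
  -- Merging loses the edge `xy` and one edge per common neighbour, at most `m` edges by the strict
  -- inequality `hm`; each counts twice.
  omega

open Classical in
/-- A family of disjoint connected vertex sets in which the average number of sets touched by a set
is at least `2 ^ r` yields a complete minor on `r + 2` vertices. -/
theorem exists_pairwise_touch {α β ι : Type*} (G : Graph α β) (r : ℕ) :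
    ∀ (A : Finset ι) (C : ι → Set α), A.Nonempty → (∀ i ∈ A, ConnectedIn G (C i)) →
      (A : Set ι).PairwiseDisjoint C →
      2 ^ r * #A ≤ ∑ i ∈ A, #{j ∈ A | i ≠ j ∧ Touch G (C i) (C j)} →
      ∃ B : Fin (r + 2) → Set α, (∀ j, ConnectedIn G (B j)) ∧
        Pairwise (Function.onFun Disjoint B) ∧ Pairwise (Function.onFun (Touch G) B) ∧
        ∀ j, B j ⊆ ⋃ i ∈ A, C i ∧ ∃ i ∈ A, C i ⊆ B j := by
  have hedge : ∀ (r : ℕ) (A : Finset ι) (C : ι → Set α), A.Nonempty →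
      2 ^ r * #A ≤ ∑ i ∈ A, #{j ∈ A | i ≠ j ∧ Touch G (C i) (C j)} →
      ∃ x ∈ A, ∃ y ∈ A, x ≠ y ∧ Touch G (C x) (C y) := by
    intro r A C hA hle
    have hpos : 0 < 2 ^ r * #A := Nat.mul_pos (by positivity) hA.card_pos
    obtain ⟨x, hx, hx'⟩ := exists_ne_zero_of_sum_ne_zero (hpos.trans_le hle).ne'
    obtain ⟨y, hy⟩ := card_ne_zero.1 hx'
    rw [mem_filter] at hy
    exact ⟨x, hx, y, hy⟩
  induction r with
  | zero =>
    intro A C hA hC hdisj hle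
    obtain ⟨x, hx, y, hy, hxy, ht⟩ := hedge 0 A C hA hle
    refine ⟨![C x, C y], ?_, ?_, ?_, ?_⟩
    · exact Fin.forall_fin_two.2 ⟨hC x hx, hC y hy⟩
    · intro i j hij
      have h1 := hdisj hx hy hxy
      have h2 := hdisj hy hx hxy.symm
      fin_cases i <;> fin_cases j <;> simp_all [Function.onFun]
    · intro i j hij
      have := ht.symm
      fin_cases i <;> fin_cases j <;> simp_all [Function.onFun]
    · exact Fin.forall_fin_two.2 ⟨⟨Set.subset_biUnion_of_mem (u := C) hx, x, hx, subset_rfl⟩,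
        Set.subset_biUnion_of_mem (u := C) hy, y, hy, subset_rfl⟩
  | succ r ih =>
    intro A
    induction hn : #A using Nat.strong_induction_on generalizing A with
    | _ n ihn =>
    subst hn
    intro C hA hC hdisj hle
    -- If some touching pair has few common neighbours, merging it keeps the average degree high.
    by_cases hcon : ∃ x ∈ A, ∃ y ∈ A, x ≠ y ∧ Touch G (C x) (C y) ∧
        #{j ∈ A | (x ≠ j ∧ Touch G (C x) (C j)) ∧ (y ≠ j ∧ Touch G (C y) (C j))} < 2 ^ r
    · obtain ⟨x, hx, y, hy, hxy, ht, hlt⟩ := hcon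
      set C' := Function.update C x (C x ∪ C y) with hC'
      have hx' : C' x = C x ∪ C y := by simp [hC']
      have hne' : ∀ i, i ≠ x → C' i = C i := fun i hi => by simp [hC', hi]
      have hmerge := sum_card_filter_le_of_merge
        (R := fun i j => i ≠ j ∧ Touch G (C i) (C j)) (R' := fun i j => i ≠ j ∧ Touch G (C' i) (C' j))
        (fun i j h => ⟨h.1.symm, h.2.symm⟩) (fun i j h => ⟨h.1.symm, h.2.symm⟩)
        (by simp) (by simp) hx hy hxy hlt
        (fun i j hix _ hjx _ h => by simpa only [hne' i hix, hne' j hjx] using h)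
        (fun j hjx hjy h => by
          refine ⟨hjx.symm, ?_⟩
          rw [hx', hne' j hjx]
          rcases h with h | h
          · exact h.2.mono Set.subset_union_left subset_rfl
          · exact h.2.mono Set.subset_union_right subset_rfl)
      have hcard : #(A.erase y) + 1 = #A := card_erase_add_one hy
      obtain ⟨B, hB, hBd, hBt, hBA⟩ := ihn #(A.erase y) (by omega) (A.erase y) rfl C'
        ⟨x, by simp [hx, hxy]⟩
        (fun i hi => by
          rcases eq_or_ne i x with rfl | hix
          · rw [hx']; exact (hC i hx).union (hC y hy) ht
          · rw [hne' i hix]; exact hC i (mem_of_mem_erase hi))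
        (by
          have key : ∀ j ∈ A, j ≠ x → j ≠ y → Disjoint (C x ∪ C y) (C j) := fun j hj hjx hjy =>
            Set.disjoint_union_left.2 ⟨hdisj hx hj hjx.symm, hdisj hy hj hjy.symm⟩
          intro i hi j hj hij
          simp only [coe_erase, Set.mem_sdiff, mem_coe, Set.mem_singleton_iff] at hi hj
          simp only [Function.onFun]
          rcases eq_or_ne i x with rfl | hix
          · rw [hx', hne' j hij.symm]; exact key j hj.1 hij.symm hj.2
          · rcases eq_or_ne j x with rfl | hjx
            · rw [hx', hne' i hij]; exact (key i hi.1 hij hi.2).symm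
            · rw [hne' i hix, hne' j hjx]; exact hdisj hi.1 hj.1 hij)
        (by
          -- The degree sum drops by at most `2 * 2 ^ r = 2 ^ (r + 1)`, while one set disappears.
          rw [← hcard] at hle
          have : 2 ^ (r + 1) = 2 * 2 ^ r := by ring
          rw [mul_add] at hle
          omega)
      refine ⟨B, hB, hBd, hBt, fun j => ⟨(hBA j).1.trans ?_, ?_⟩⟩
      · refine Set.iUnion₂_subset fun i hi => ?_
        rcases eq_or_ne i x with rfl | hix
        · rw [hx']
          exact Set.union_subset (Set.subset_biUnion_of_mem (u := C) hx)
            (Set.subset_biUnion_of_mem (u := C) hy)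
        · rw [hne' i hix]
          exact Set.subset_biUnion_of_mem (u := C) (mem_of_mem_erase hi)
      · obtain ⟨i, hi, hij⟩ := (hBA j).2
        refine ⟨i, mem_of_mem_erase hi, subset_trans ?_ hij⟩
        rcases eq_or_ne i x with rfl | hix
        · rw [hx']; exact Set.subset_union_left
        · rw [hne' i hix]
    · push Not at hcon
      obtain ⟨x, hx, y, hy, hxy, ht⟩ := hedge (r + 1) A C hA hle
      -- Now every touching pair has at least `2 ^ r` common neighbours, so all degrees inside the
      -- neighbourhood `N` of `x` are at least `2 ^ r`. A complete minor found in `N` is extended by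
      -- `C x`.
      set N := {j ∈ A | x ≠ j ∧ Touch G (C x) (C j)} with hN
      have hNA : N ⊆ A := filter_subset _ _
      have hNx : ∀ i ∈ N, x ≠ i ∧ Touch G (C x) (C i) := fun i hi => (mem_filter.1 hi).2
      obtain ⟨B, hB, hBd, hBt, hBA⟩ := ih N C ⟨y, mem_filter.2 ⟨hy, hxy, ht⟩⟩
        (fun i hi => hC i (hNA hi)) (hdisj.subset (coe_subset.2 hNA)) (by
          rw [mul_comm, ← smul_eq_mul]
          refine card_nsmul_le_sum _ _ _ fun i hi => ?_
          refine (hcon x hx i (hNA hi) (hNx i hi).1 (hNx i hi).2).trans (le_of_eq ?_)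
          rw [hN, filter_filter])
      have hxB : ∀ j, Disjoint (C x) (B j) := fun j => by
        refine Disjoint.mono_right (hBA j).1 (Set.disjoint_iUnion₂_right.2 fun i hi => ?_)
        exact hdisj hx (hNA hi) (hNx i hi).1
      have htB : ∀ j, Touch G (C x) (B j) := fun j => by
        obtain ⟨i, hi, hij⟩ := (hBA j).2
        exact (hNx i hi).2.mono subset_rfl hij
      refine ⟨Fin.cons (C x) B, ?_, ?_, ?_, ?_⟩
      · exact Fin.cases (hC x hx) hB
      · refine Fin.cases (Fin.cases (fun h => absurd rfl h) fun j _ => hxB j) fun i =>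
          Fin.cases (fun _ => (hxB i).symm) fun j hij => hBd fun h => hij (congrArg Fin.succ h)
      · refine Fin.cases (Fin.cases (fun h => absurd rfl h) fun j _ => htB j) fun i =>
          Fin.cases (fun _ => (htB i).symm) fun j hij => hBt fun h => hij (congrArg Fin.succ h)
      · refine Fin.cases ⟨Set.subset_biUnion_of_mem (u := C) hx, x, hx, subset_rfl⟩ fun j => ?_
        obtain ⟨h1, i, hi, hij⟩ := hBA j
        exact ⟨h1.trans (Set.biUnion_subset_biUnion_left hNA), i, hNA hi, hij⟩

end

/-! ### The edge bound for touching graphs. -/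

variable {α β : Type*}

/-- The simple graph in which two sets of a family are adjacent if they touch. -/
def touchGraph {ι : Type*} (G : Graph α β) (C : ι → Set α) : SimpleGraph ι where
  Adj i j := i ≠ j ∧ Touch G (C i) (C j)
  symm := ⟨fun _ _ h => ⟨h.1.symm, h.2.symm⟩⟩
  loopless := ⟨fun _ h => h.1 rfl⟩

/-- The touching graph of disjoint connected vertex sets of a planar graph has at most six times as
many edges as vertices. -/
theorem IsPlanar.encard_edgeSet_touchGraph_le {ι : Type*} [Finite ι] {G : Graph α β}
    (hG : IsPlanar G) (C : ι → Set α) (hV : ∀ i, C i ⊆ G.vertexSet)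
    (hC : ∀ i, ConnectedIn G (C i)) (hdisj : Pairwise (Function.onFun Disjoint C)) :
    (touchGraph G C).edgeSet.encard ≤ 6 * ENat.card ι := by
  classical
  have := Fintype.ofFinite ι
  rw [← SimpleGraph.coe_edgeFinset, Set.encard_coe_eq_coe_finsetCard, ENat.card_eq_coe_fintype_card]
  norm_cast
  by_contra! hlt
  have hne : Nonempty ι := by
    obtain ⟨e, -⟩ := Finset.card_pos.1 (Nat.zero_le _ |>.trans_lt hlt)
    exact ⟨e.out.1⟩
  have hdeg := (touchGraph G C).sum_degrees_eq_twice_card_edges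
  simp only [SimpleGraph.degree] at hdeg
  -- `r = 3` gives five sets and needs degree sum `8 * |ι|`; more than `6 * |ι|` edges give over `12
  -- * |ι|`.
  obtain ⟨B, hB, hBd, hBt, hBC⟩ := exists_pairwise_touch G 3 Finset.univ C Finset.univ_nonempty
    (fun i _ => hC i) (fun i _ j _ hij => hdisj hij) (by
      rw [Finset.card_univ]
      refine le_trans ?_ (le_of_eq (Eq.trans hdeg.symm ?_))
      · omega
      · exact Finset.sum_congr rfl fun i _ => by congr 1; ext j; rw [SimpleGraph.mem_neighborFinset]; simp [touchGraph])
  exact hG.not_pairwise_touch B hB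
    (fun j => (hBC j).1.trans (Set.iUnion₂_subset fun i _ => hV i)) hBd hBt

/-! ### Simplifications, contractions and fibers. -/

/-- Otherwise the edge could be added to `H`, against maximality. Hence the choice of
representatives among parallel edges does not affect adjacency. -/
theorem IsMaximalSimpleSubgraph.adj {G H : Graph α β} (h : IsMaximalSimpleSubgraph H G) {x y : α}
    (hxy : G.Adj x y) (hne : x ≠ y) : H.Adj x y := by
  obtain ⟨e, he⟩ := hxy
  by_contra hH
  have := h.prop.2
  have hle : H ≤ G.restrict (insert e H.edgeSet) :=
    ⟨h.prop.1.vertexSet_mono, fun f a b hf => ⟨.inr hf.edge_mem, hf.mono h.prop.1⟩⟩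
  have hsimple : (G.restrict (insert e H.edgeSet)).Simple := by
    have hHl : ∀ {f a b}, f ∈ H.edgeSet → G.IsLink f a b → H.IsLink f a b := fun hf hl =>
      (Graph.IsSubgraph.isLink_iff h.prop.1 hf).2 hl
    have hno : ∀ {f a b}, f ∈ H.edgeSet → G.IsLink f a b → ¬ G.IsLink e a b := fun hf hl hl' => by
      rcases he.eq_and_eq_or_eq_and_eq hl' with ⟨rfl, rfl⟩ | ⟨rfl, rfl⟩
      exacts [hH ⟨_, hHl hf hl⟩, hH ⟨_, (hHl hf hl).symm⟩]
    refine { not_isLoopAt := ?_, eq_of_isLink := ?_ }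
    · rintro f z ⟨rfl | hf, hl⟩
      · rcases he.eq_and_eq_or_eq_and_eq hl with ⟨rfl, rfl⟩ | ⟨rfl, rfl⟩ <;> exact hne rfl
      · exact (hHl hf hl).ne rfl
    · rintro f g a b ⟨rfl | hf, hl⟩ ⟨rfl | hg, hl'⟩
      · rfl
      · exact absurd hl (hno hg hl')
      · exact absurd hl' (hno hf hl)
      · exact (hHl hf hl).eq (hHl hg hl')
  have hmem : e ∈ H.edgeSet := Graph.IsSubgraph.edgeSet_mono
    (h.le_of_ge ⟨Graph.restrict_le, hsimple⟩ hle) ⟨he.edge_mem, .inl rfl⟩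
  exact hH ⟨e, (Graph.IsSubgraph.isLink_iff h.prop.1 hmem).2 he⟩

theorem Contraction.merge_u (c : Contraction α β) : c.merge c.u = c.s := by simp [merge]

theorem Contraction.merge_v (c : Contraction α β) : c.merge c.v = c.s := by simp [merge]

theorem Contraction.merge_of_ne (c : Contraction α β) {x : α} (hu : x ≠ c.u) (hv : x ≠ c.v) :
    c.merge x = x := by simp [merge, hu, hv]

theorem Contraction.IsValid.merge_eq_s_iff {c : Contraction α β} {G : Graph α β} (h : c.IsValid G)
    {x : α} (hx : x ∈ G.vertexSet) : c.merge x = c.s ↔ x = c.u ∨ x = c.v := by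
  refine ⟨fun hs => ?_, by rintro (rfl | rfl); exacts [c.merge_u, c.merge_v]⟩
  by_contra! hne
  rw [c.merge_of_ne hne.1 hne.2] at hs
  exact h.fresh (hs ▸ ⟨hx, by simp [hne]⟩)

theorem Contraction.IsValid.merge_eq_merge_iff {c : Contraction α β} {G : Graph α β}
    (h : c.IsValid G) {x y : α} (hx : x ∈ G.vertexSet) (hy : y ∈ G.vertexSet) :
    c.merge x = c.merge y ↔ x = y ∨ (x = c.u ∨ x = c.v) ∧ (y = c.u ∨ y = c.v) := by
  by_cases hys : y = c.u ∨ y = c.v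
  · rw [(h.merge_eq_s_iff hy).2 hys, h.merge_eq_s_iff hx]
    constructor
    · exact fun hxs => .inr ⟨hxs, hys⟩
    · rintro (rfl | h)
      exacts [hys, h.1]
  · rw [or_iff_left (fun h => hys h.2)]
    refine ⟨fun hxy => ?_, fun h => h ▸ rfl⟩
    by_cases hxs : x = c.u ∨ x = c.v
    · exact absurd ((h.merge_eq_s_iff hy).1 (hxy ▸ (h.merge_eq_s_iff hx).2 hxs)) hys
    · push Not at hxs hys
      rwa [c.merge_of_ne hxs.1 hxs.2, c.merge_of_ne hys.1 hys.2] at hxy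

theorem vertexSet_graphAfter (G : Graph α β) (c : ℕ → Contraction α β) (i : ℕ) :
    (graphAfter G c i).vertexSet = phi c i '' G.vertexSet := by
  induction i with
  | zero => simp [graphAfter, phi]
  | succ i ih =>
    rw [phi, Set.image_comp, ← ih]
    rfl

theorem isLink_graphAfter_succ {G : Graph α β} {c : ℕ → Contraction α β} {i : ℕ} {e : β} {x y : α} :
    (graphAfter G c (i + 1)).IsLink e x y ↔ ∃ p q, (graphAfter G c i).IsLink e p q ∧
      e ≠ (c i).edge ∧ (c i).merge p = x ∧ (c i).merge q = y := by
  constructor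
  · rintro ⟨p, q, ⟨h, he⟩, hp, hq⟩
    exact ⟨p, q, h, he, hp, hq⟩
  · rintro ⟨p, q, h, he, hp, hq⟩
    exact ⟨p, q, ⟨h, he⟩, hp, hq⟩

theorem exists_isLink_of_isLink_graphAfter {G : Graph α β} {c : ℕ → Contraction α β} {i : ℕ}
    {e : β} {x y : α} (h : (graphAfter G c i).IsLink e x y) :
    ∃ a b, G.IsLink e a b ∧ phi c i a = x ∧ phi c i b = y := by
  induction i generalizing x y with
  | zero => exact ⟨x, y, h, rfl, rfl⟩
  | succ i ih =>
    obtain ⟨p, q, hpq, -, rfl, rfl⟩ := isLink_graphAfter_succ.1 h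
    obtain ⟨a, b, hab, rfl, rfl⟩ := ih hpq
    exact ⟨a, b, hab, rfl, rfl⟩

/-- An edge disappears only by being contracted, and then its ends are merged for good. -/
theorem IsContractionSequence.isLink_graphAfter {G : Graph α β} {k : ℕ} {c : ℕ → Contraction α β}
    (hc : IsContractionSequence G k c) {i : ℕ} (hi : i ≤ k) {e : β} {a b : α}
    (h : G.IsLink e a b) (hne : phi c i a ≠ phi c i b) :
    (graphAfter G c i).IsLink e (phi c i a) (phi c i b) := by
  induction i with
  | zero => exact h
  | succ i ih =>
    have hl := ih (by omega) fun heq => hne (congrArg (c i).merge heq)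
    refine isLink_graphAfter_succ.2 ⟨_, _, hl, ?_, rfl, rfl⟩
    rintro rfl
    refine hne ?_
    change (c i).merge _ = (c i).merge _
    rcases (hc i hi).isLink.eq_and_eq_or_eq_and_eq hl with ⟨h1, h2⟩ | ⟨h1, h2⟩ <;>
      rw [← h1, ← h2, (c i).merge_u, (c i).merge_v]

/-- A new fiber is an old one or the union of the fibers over `u` and `v`, which touch along the
contracted edge, seen in `G`. -/
theorem IsContractionSequence.connectedIn_fiber {G : Graph α β} {k : ℕ} {c : ℕ → Contraction α β}
    (hc : IsContractionSequence G k c) {i : ℕ} (hi : i ≤ k) {z : α}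
    (hz : z ∈ (graphAfter G c i).vertexSet) :
    ConnectedIn G {x | x ∈ G.vertexSet ∧ phi c i x = z} := by
  induction i generalizing z with
  | zero =>
    convert connectedIn_singleton G z using 1
    ext x
    exact ⟨fun h => h.2, fun h => ⟨h ▸ hz, h⟩⟩
  | succ i ih =>
    have hv := hc i hi
    have hmem : ∀ x ∈ G.vertexSet, phi c i x ∈ (graphAfter G c i).vertexSet := fun x hx => by
      rw [vertexSet_graphAfter]; exact ⟨x, hx, rfl⟩
    rw [vertexSet_graphAfter] at hz
    obtain ⟨x, hx, rfl⟩ := hz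
    by_cases hxs : phi c i x = (c i).u ∨ phi c i x = (c i).v
    · obtain ⟨a, b, hab, ha, hb⟩ := exists_isLink_of_isLink_graphAfter hv.isLink
      convert (ih (by omega) hv.isLink.left_mem).union (ih (by omega) hv.isLink.right_mem)
        ⟨a, ⟨hab.left_mem, ha⟩, b, ⟨hab.right_mem, hb⟩, ⟨_, hab⟩⟩ using 1
      ext y
      have : y ∈ G.vertexSet → (phi c (i + 1) y = phi c (i + 1) x ↔ _) := fun hy =>
        hv.merge_eq_merge_iff (hmem y hy) (hmem x hx)
      simp only [Set.mem_ofPred_eq, Set.mem_union]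
      constructor
      · rintro ⟨hy, hyx⟩
        rcases (this hy).1 hyx with h | h
        · rw [h]; tauto
        · tauto
      · rintro (⟨hy, hyx⟩ | ⟨hy, hyx⟩) <;> exact ⟨hy, (this hy).2 (.inr ⟨by tauto, hxs⟩)⟩
    · convert ih (by omega) (hmem x hx) using 1
      ext y
      have : y ∈ G.vertexSet → (phi c (i + 1) y = phi c (i + 1) x ↔ _) := fun hy =>
        hv.merge_eq_merge_iff (hmem y hy) (hmem x hx)
      simp only [Set.mem_ofPred_eq]
      tauto

/-! ### New edges and cluster families. -/

/-- An edge that is new after a contraction comes from an end of the contracted edge outside the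
image of `W`, while the other end is in the image and was not adjacent to the far vertex. -/
theorem exists_isLink_of_mem_newEdges {G : Graph α β} {k : ℕ} {c : ℕ → Contraction α β}
    (hc : IsContractionSequence G k c) {Gbar : ℕ → Graph α β}
    (hbar : ∀ i ≤ k, IsMaximalSimpleSubgraph (Gbar i) (graphAfter G c i))
    {W : Set α} (hW : W ⊆ G.vertexSet) {i : ℕ} (hi : i < k) {e : β}
    (he : e ∈ newEdges c Gbar W i) :
    ∃ y ∈ phi c i '' W, y ≠ (c i).u ∧ y ≠ (c i).v ∧ (Gbar (i + 1)).IsLink e (c i).s y ∧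
      ((c i).u ∈ phi c i '' W ∧ (c i).v ∉ phi c i '' W ∧ ¬ (graphAfter G c i).Adj (c i).u y ∧
          (graphAfter G c i).IsLink e (c i).v y ∨
        (c i).v ∈ phi c i '' W ∧ (c i).u ∉ phi c i '' W ∧ ¬ (graphAfter G c i).Adj (c i).v y ∧
          (graphAfter G c i).IsLink e (c i).u y) := by
  obtain ⟨y, hl, hsW, hyW, hu, hv⟩ := he
  have hval := hc i hi
  have := (hbar (i + 1) hi).prop.2
  have hsy : (c i).s ≠ y := hl.ne
  have hmem : ∀ x ∈ W, phi c i x ∈ (graphAfter G c i).vertexSet := fun x hx => by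
    rw [vertexSet_graphAfter]; exact ⟨x, hW hx, rfl⟩
  obtain ⟨p, q, hpq, -, hp, hq⟩ := isLink_graphAfter_succ.1 (hl.mono (hbar (i + 1) hi).prop.1)
  have hp' := (hval.merge_eq_s_iff hpq.left_mem).1 hp
  have hqu : q ≠ (c i).u := by rintro rfl; exact hsy ((c i).merge_u.symm.trans hq)
  have hqv : q ≠ (c i).v := by rintro rfl; exact hsy ((c i).merge_v.symm.trans hq)
  obtain rfl : q = y := ((c i).merge_of_ne hqu hqv).symm.trans hq
  have hqW : q ∈ phi c i '' W := by
    obtain ⟨w, hw, hwq⟩ := hyW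
    refine ⟨w, hw, ?_⟩
    have := (hval.merge_eq_merge_iff (hmem w hw) hpq.right_mem).1 (hwq.trans hq.symm)
    tauto
  have hsW' : (c i).u ∈ phi c i '' W ∨ (c i).v ∈ phi c i '' W := by
    obtain ⟨w, hw, hws⟩ := hsW
    rcases (hval.merge_eq_s_iff (hmem w hw)).1 hws with h | h
    exacts [.inl ⟨w, hw, h⟩, .inr ⟨w, hw, h⟩]
  refine ⟨q, hqW, hqu, hqv, hl, ?_⟩
  have hadj : ∀ z, z ≠ q → (graphAfter G c i).Adj z q → (Gbar i).Adj z q := fun z hz h =>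
    (hbar i hi.le).adj h hz
  -- `e` itself makes its end `p` adjacent to `q`, so newness puts `p` outside the image of `W`; the
  -- other contracted end must then be inside and not adjacent to `q`.
  rcases hp' with rfl | rfl
  · have hu' := hu.resolve_right (not_not.2 (hadj _ hqu.symm ⟨e, hpq⟩))
    have hvW := hsW'.resolve_left hu'
    have hv' := hv.resolve_left (not_not.2 hvW)
    exact .inr ⟨hvW, hu', fun h => hv' (hadj _ hqv.symm h), hpq⟩
  · have hv' := hv.resolve_right (not_not.2 (hadj _ hqv.symm ⟨e, hpq⟩))
    have huW := hsW'.resolve_right hv'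
    have hu' := hu.resolve_left (not_not.2 huW)
    exact .inl ⟨huW, hv', fun h => hu' (hadj _ hqu.symm h), hpq⟩

/-- A family of disjoint connected sets, indexed by the vertices in `W`, that splits the fibers of
`φ` over the image of `W`. -/
structure IsClusterFamily (G : Graph α β) (φ : α → α) (W : Set α) (C : W → Set α) : Prop where
  connectedIn : ∀ w, ConnectedIn G (C w)
  disjoint : Pairwise (Function.onFun Disjoint C)
  subset : ∀ w, C w ⊆ G.vertexSet
  map_eq : ∀ w, ∀ x ∈ C w, φ x = φ w
  exists_mem : ∀ x ∈ G.vertexSet, φ x ∈ φ '' W → ∃ w, x ∈ C w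

/-- Enlarging one set of a cluster family by a whole fiber outside the image of `W` creates at
least as many adjacencies as there are vertices of the image newly reached. -/
theorem IsClusterFamily.exists_absorb {G : Graph α β} {φ : α → α} {W : Set α} {C : W → Set α}
    (hC : IsClusterFamily G φ W C) {u v : α} (hu : u ∈ φ '' W) (hv : v ∉ φ '' W)
    (hF : ConnectedIn G {x | x ∈ G.vertexSet ∧ φ x = v})
    (huv : ∃ a b, G.Adj a b ∧ φ a = u ∧ φ b = v)
    (D : Set β) (Y : β → α) (hY : Set.InjOn Y D)
    (hD : ∀ e ∈ D, Y e ∈ φ '' W ∧ Y e ≠ u ∧ (∃ a b, G.Adj a b ∧ φ a = v ∧ φ b = Y e) ∧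
      ∀ a b, G.Adj a b → φ a = u → φ b ≠ Y e) :
    ∃ (w₀ : W) (C' : W → Set α), φ w₀ = u ∧
      (∀ w x, x ∈ C' w ↔ x ∈ C w ∨ w = w₀ ∧ x ∈ G.vertexSet ∧ φ x = v) ∧
      (∀ w, ConnectedIn G (C' w)) ∧ Pairwise (Function.onFun Disjoint C') ∧
      D.encard + (touchGraph G C).edgeSet.encard ≤ (touchGraph G C').edgeSet.encard := by
  classical
  obtain ⟨a, b, hab, ha, hb⟩ := huv
  -- The absorbing cluster contains the end `a` of an edge into the fiber of `v`, so it stays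
  -- connected.
  obtain ⟨w₀, haw⟩ := hC.exists_mem a hab.left_mem (ha ▸ hu)
  have hw₀ : φ w₀ = u := (hC.map_eq w₀ a haw).symm.trans ha
  set F := {x | x ∈ G.vertexSet ∧ φ x = v} with hFdef
  let C' := Function.update C w₀ (C w₀ ∪ F)
  have h0 : C' w₀ = C w₀ ∪ F := by simp [C']
  have h1 : ∀ w, w ≠ w₀ → C' w = C w := fun w hw => by simp [C', hw]
  have hmem : ∀ w x, x ∈ C' w ↔ x ∈ C w ∨ w = w₀ ∧ x ∈ G.vertexSet ∧ φ x = v := fun w x => by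
    rcases eq_or_ne w w₀ with rfl | hw
    · rw [h0]; simp [F]
    · rw [h1 w hw]; simp [hw]
  have hsub : ∀ w, C w ⊆ C' w := fun w x hx => (hmem w x).2 (.inl hx)
  refine ⟨w₀, C', hw₀, hmem, fun w => ?_, fun w w' hw => ?_, ?_⟩
  · rcases eq_or_ne w w₀ with rfl | hw
    · rw [h0]
      exact (hC.connectedIn w).union hF ⟨a, haw, b, ⟨hab.right_mem, hb⟩, hab⟩
    · rw [h1 w hw]; exact hC.connectedIn w
  · refine Set.disjoint_left.2 fun x hx hx' => ?_
    have hout : ∀ w, x ∈ C w → φ x ≠ v := fun w hxw hxv =>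
      hv ⟨w, w.2, (hC.map_eq w x hxw).symm.trans hxv⟩
    rcases (hmem w x).1 hx with hxw | ⟨rfl, -, hxv⟩ <;>
      rcases (hmem w' x).1 hx' with hxw' | ⟨rfl, -, hxv'⟩
    · exact Set.disjoint_left.1 (hC.disjoint hw) hxw hxw'
    · exact hout w hxw hxv'
    · exact hout w' hxw' hxv
    · exact hw rfl
  -- `w` owns an end over `Y e` of an edge from the fiber of `v`. The old cluster did not touch it,
  -- since no edge joins the fibers of `u` and `Y e`.
  · have hex : ∀ e, ∃ w : W, e ∈ D → φ w = Y e ∧ w₀ ≠ w ∧ Touch G (C' w₀) (C' w) ∧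
        ¬ Touch G (C w₀) (C w) := by
      intro e
      by_cases he : e ∈ D
      · obtain ⟨hYW, hYu, ⟨p, q, hpq, hp, hq⟩, hno⟩ := hD e he
        obtain ⟨w, hqw⟩ := hC.exists_mem q hpq.right_mem (hq ▸ hYW)
        have hw : φ w = Y e := (hC.map_eq w q hqw).symm.trans hq
        refine ⟨w, fun _ => ⟨hw, ?_, ?_, ?_⟩⟩
        · rintro rfl
          exact hYu (hw.symm.trans hw₀)
        · exact ⟨p, (hmem _ _).2 (.inr ⟨rfl, hpq.left_mem, hp⟩), q, hsub w hqw, hpq⟩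
        · rintro ⟨p, hp, q, hq, hpq⟩
          exact hno p q hpq ((hC.map_eq _ _ hp).trans hw₀) ((hC.map_eq _ _ hq).trans hw)
      · exact ⟨w₀, fun h => absurd h he⟩
    choose g hg using hex
    have hinj : Set.InjOn (fun e => s(w₀, g e)) D := fun e he e' he' hee => by
      have : g e = g e' := Sym2.congr_right.1 hee
      exact hY he he' ((hg e he).1.symm.trans (this ▸ (hg e' he').1))
    rw [← hinj.encard_image, ← Set.encard_union_eq]
    · refine Set.encard_le_encard (Set.union_subset ?_ ?_)
      · rintro _ ⟨e, he, rfl⟩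
        exact ⟨(hg e he).2.1, (hg e he).2.2.1⟩
      · refine SimpleGraph.edgeSet_mono fun w w' h => ⟨h.1, h.2.mono (hsub w) (hsub w')⟩
    · rw [Set.disjoint_left]
      rintro _ ⟨e, he, rfl⟩ h
      exact (hg e he).2.2.2 h.2

/-- Every contraction can be followed by a change of the cluster family in which the new edges give
new adjacencies. -/
theorem exists_isClusterFamily_succ {G : Graph α β} {k : ℕ} {c : ℕ → Contraction α β}
    (hc : IsContractionSequence G k c) {Gbar : ℕ → Graph α β}
    (hbar : ∀ i ≤ k, IsMaximalSimpleSubgraph (Gbar i) (graphAfter G c i))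
    {W : Set α} (hW : W ⊆ G.vertexSet) {i : ℕ} (hi : i < k) {C : W → Set α}
    (hC : IsClusterFamily G (phi c i) W C) :
    ∃ C', IsClusterFamily G (phi c (i + 1)) W C' ∧
      (newEdges c Gbar W i).encard + (touchGraph G C).edgeSet.encard ≤
        (touchGraph G C').edgeSet.encard := by
  have hval := hc i hi
  have := (hbar (i + 1) hi).prop.2
  have hmem : ∀ x ∈ G.vertexSet, phi c i x ∈ (graphAfter G c i).vertexSet := fun x hx => by
    rw [vertexSet_graphAfter]; exact ⟨x, hx, rfl⟩
  have hphi : ∀ x ∈ G.vertexSet, ∀ y ∈ G.vertexSet, (phi c (i + 1) x = phi c (i + 1) y ↔ _) :=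
    fun x hx y hy => hval.merge_eq_merge_iff (hmem x hx) (hmem y hy)
  have hnew := fun e he => exists_isLink_of_mem_newEdges hc hbar hW hi (e := e) he
  have hY : ∀ e, ∃ y, e ∈ newEdges c Gbar W i → y ∈ phi c i '' W ∧ y ≠ (c i).u ∧ y ≠ (c i).v ∧
      (Gbar (i + 1)).IsLink e (c i).s y ∧ _ := fun e => by
    by_cases he : e ∈ newEdges c Gbar W i
    · obtain ⟨y, hy⟩ := hnew e he
      exact ⟨y, fun _ => hy⟩
    · exact ⟨(c i).u, fun h => absurd h he⟩
  choose Y hY using hY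
  -- Two new edges with the same far end would be parallel in the simple graph `Gbar (i + 1)`.
  have hYinj : Set.InjOn Y (newEdges c Gbar W i) := fun e he e' he' hee =>
    (hY e he).2.2.2.1.eq (hee ▸ (hY e' he').2.2.2.1)
  have absorb : ∀ u v, (u = (c i).u ∧ v = (c i).v ∨ u = (c i).v ∧ v = (c i).u) →
      u ∈ phi c i '' W → v ∉ phi c i '' W → ∃ C', IsClusterFamily G (phi c (i + 1)) W C' ∧
      (newEdges c Gbar W i).encard + (touchGraph G C).edgeSet.encard ≤
        (touchGraph G C').edgeSet.encard := by
    intro u v huv hu hv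
    have hl : (graphAfter G c i).IsLink (c i).edge u v := by
      rcases huv with ⟨rfl, rfl⟩ | ⟨rfl, rfl⟩
      exacts [hval.isLink, hval.isLink.symm]
    obtain ⟨w₀, C', hw₀, hC', hconn, hdisj, hle⟩ := hC.exists_absorb hu hv
      (hc.connectedIn_fiber hi.le hl.right_mem)
      (by
        obtain ⟨a, b, hab, ha, hb⟩ := exists_isLink_of_isLink_graphAfter hl
        exact ⟨a, b, ⟨_, hab⟩, ha, hb⟩)
      (newEdges c Gbar W i) Y hYinj (by
        intro e he
        obtain ⟨h1, h2, h3, -, h4⟩ := hY e he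
        obtain ⟨h5, h6⟩ : ¬ (graphAfter G c i).Adj u (Y e) ∧
            (graphAfter G c i).IsLink e v (Y e) := by
          rcases huv with ⟨rfl, rfl⟩ | ⟨rfl, rfl⟩ <;> tauto
        have hYu : Y e ≠ u := by
          rcases huv with ⟨rfl, rfl⟩ | ⟨rfl, rfl⟩ <;> assumption
        refine ⟨h1, hYu, ?_, ?_⟩
        · obtain ⟨a, b, hab, ha, hb⟩ := exists_isLink_of_isLink_graphAfter h6
          exact ⟨a, b, ⟨_, hab⟩, ha, hb⟩
        · rintro a b ⟨f, hf⟩ ha hb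
          refine h5 ⟨f, ?_⟩
          have := hc.isLink_graphAfter hi.le hf (by rw [ha, hb]; exact hYu.symm)
          rwa [ha, hb] at this)
    refine ⟨C', ⟨hconn, hdisj, fun w x hx => ?_, fun w x hx => ?_, fun x hx hxW => ?_⟩, hle⟩
    · rcases (hC' w x).1 hx with h | h
      exacts [hC.subset w h, h.2.1]
    · rcases (hC' w x).1 hx with h | ⟨rfl, hxV, hxv⟩
      · exact congrArg (c i).merge (hC.map_eq w x h)
      · refine (hphi x hxV w (hW w.2)).2 (.inr ?_)
        rw [hxv, hw₀]
        rcases huv with ⟨rfl, rfl⟩ | ⟨rfl, rfl⟩ <;> simp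
    · by_cases hxv : phi c i x = v
      · exact ⟨w₀, (hC' _ _).2 (.inr ⟨rfl, hx, hxv⟩)⟩
      · obtain ⟨w, hw, hwx⟩ := hxW
        have hxW' : phi c i x ∈ phi c i '' W := by
          rcases (hphi w (hW hw) x hx).1 hwx with h | h
          · exact ⟨w, hw, h⟩
          · have : phi c i x = u := by
              rcases huv with ⟨rfl, rfl⟩ | ⟨rfl, rfl⟩ <;> tauto
            exact this ▸ hu
        obtain ⟨w', hw'⟩ := hC.exists_mem x hx hxW'
        exact ⟨w', (hC' _ _).2 (.inl hw')⟩
  by_cases hu : (c i).u ∈ phi c i '' W <;> by_cases hv : (c i).v ∈ phi c i '' W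
  rotate_left
  · exact absorb _ _ (.inl ⟨rfl, rfl⟩) hu hv
  · exact absorb _ _ (.inr ⟨rfl, rfl⟩) hv hu
  -- Both ends or neither in the image of `W`: no edge is new, and the old clusters still serve.
  -- When both are, clusters sharing a fiber remain separate.
  all_goals
    have hempty : newEdges c Gbar W i = ∅ := by
      refine Set.eq_empty_of_forall_notMem fun e he => ?_
      obtain ⟨y, -, -, -, -, h⟩ := hnew e he
      tauto
    refine ⟨C, ⟨hC.connectedIn, hC.disjoint, hC.subset,
      fun w x hx => congrArg (c i).merge (hC.map_eq w x hx), fun x hx hxW => ?_⟩, by simp [hempty]⟩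
    refine hC.exists_mem x hx ?_
    obtain ⟨w, hw, hwx⟩ := hxW
    have hwW : phi c i w ∈ phi c i '' W := ⟨w, hw, rfl⟩
    rcases (hphi w (hW hw) x hx).1 hwx with h | ⟨h | h, h' | h'⟩ <;> simp_all

theorem isClusterFamily_singleton (G : Graph α β) {W : Set α} (hW : W ⊆ G.vertexSet) :
    IsClusterFamily G id W (fun w => {w.1}) where
  connectedIn w := connectedIn_singleton G w.1
  disjoint w w' h := by simpa [Function.onFun, Subtype.ext_iff] using h
  subset w := by simpa using hW w.2
  map_eq w x hx := by simpa using hx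
  exists_mem x _ hx := by simpa using hx

/-- The new edges over the first contractions are bounded by the number of adjacencies in some
cluster family. -/
theorem exists_isClusterFamily_psi_le {G : Graph α β} {k : ℕ} {c : ℕ → Contraction α β}
    (hc : IsContractionSequence G k c) {Gbar : ℕ → Graph α β}
    (hbar : ∀ i ≤ k, IsMaximalSimpleSubgraph (Gbar i) (graphAfter G c i))
    {W : Set α} (hW : W ⊆ G.vertexSet) {i : ℕ} (hi : i ≤ k) :
    ∃ C, IsClusterFamily G (phi c i) W C ∧ psi c Gbar i W ≤ (touchGraph G C).edgeSet.encard := by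
  induction i with
  | zero => exact ⟨_, isClusterFamily_singleton G hW, by simp [psi]⟩
  | succ i ih =>
    obtain ⟨C, hC, hle⟩ := ih (by omega)
    obtain ⟨C', hC', hle'⟩ := exists_isClusterFamily_succ hc hbar hW hi hC
    refine ⟨C', hC', le_trans ?_ hle'⟩
    rw [psi, Finset.sum_range_succ, add_comm]
    exact add_le_add_right hle _

end PlanarContraction

theorem mainTheorem9 {α β : Type*} (G₀ : Graph α β) (hfin : G₀.vertexSet.Finite)
    (hsimple : G₀.Simple) (hplanar : PlanarContraction.IsPlanar G₀)
    (k : ℕ) (c : ℕ → PlanarContraction.Contraction α β)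
    (hc : PlanarContraction.IsContractionSequence G₀ k c)
    (Gbar : ℕ → Graph α β)
    (hbar : ∀ i ≤ k, PlanarContraction.IsMaximalSimpleSubgraph (Gbar i)
      (PlanarContraction.graphAfter G₀ c i))
    (W : Set α) (hW : W ⊆ G₀.vertexSet) :
    PlanarContraction.psi c Gbar k W ≤ 6 * W.encard := by
  obtain ⟨C, hC, hle⟩ := PlanarContraction.exists_isClusterFamily_psi_le hc hbar hW le_rfl
  have := (hfin.subset hW).to_subtype
  exact hle.trans (hplanar.encard_edgeSet_touchGraph_le C hC.subset hC.connectedIn hC.disjoint)
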